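/- Let $\Omega\subset\mathbb{R}^n$ be a bounded domain (a non-empty, open, connected and bounded set), and let $F:\Omega\to\mathbb{R}$ be continuous with $$\inf_{\Omega}F>0\qquad\text{or}\qquad \sup_{\Omega}F<0 .$$ For a $C^2$ function $\phi$ write $$\Delta_\infty\phi=\sum_{i,j=1}^n\frac{\partial\phi}{\partial x_i}\frac{\partial\phi}{\partial x_j}\frac{\partial^2\phi}{\partial x_i\,\partial x_j}.$$ Let $u,v\in C(\overline\Omega)$ be real-valued functions such that, in the viscosity sense, $$\Delta_\infty v\le F\qquad\text{and}\qquad\Delta_\infty u\ge F\qquad\text{in }\Omega .$$ That is: $\Delta_\infty\phi(x_0)\le F(x_0)$ whenever $x_0\in\Omega$ and $\phi\in C^2(\Omega)$ satisfy $\phi(x_0)=v(x_0)$ and $\phi(x)<v(x)$ for all $x\in\Omega\setminus\{x_0\}$; and $\Delta_\infty\psi(x_0)\ge F(x_0)$ whenever $x_0\in\Omega$ and $\psi\in C^2(\Omega)$ satisfy $\psi(x_0)=u(x_0)$ and $\psi(x)>u(x)$ for all $x\in\Omega\setminus\{x_0\}$. If $v\ge u$ on $\partial\Omega$, then $v\ge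 u$ in $\Omega$. -/

import Mathlib

/-- The `∞`-Laplace operator on functions of `n` real variables, evaluated at the point `x`:
`Δ_∞ φ (x) = ∑_{i,j} (∂φ/∂x_i) (∂φ/∂x_j) (∂²φ/∂x_i∂x_j)`. It is only applied to functions that
are of class `C²` in a neighbourhood of `x`. -/
noncomputable def infinityLaplacian {n : ℕ} (φ : EuclideanSpace ℝ (Fin n) → ℝ)
    (x : EuclideanSpace ℝ (Fin n)) : ℝ :=
  ∑ i : Fin n, ∑ j : Fin n,
    fderiv ℝ φ x (EuclideanSpace.single i 1) * fderiv ℝ φ x (EuclideanSpace.single j 1) *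
      fderiv ℝ (fderiv ℝ φ) x (EuclideanSpace.single i 1) (EuclideanSpace.single j 1)

/-- `φ` touches `v` (strictly) from below at the point `x₀`, relative to the set `Ω`. -/
def TouchesFromBelow {n : ℕ} (Ω : Set (EuclideanSpace ℝ (Fin n)))
    (φ v : EuclideanSpace ℝ (Fin n) → ℝ) (x₀ : EuclideanSpace ℝ (Fin n)) : Prop :=
  v x₀ = φ x₀ ∧ ∀ x ∈ Ω, x ≠ x₀ → φ x < v x

/-- `ψ` touches `u` (strictly) from above at the point `x₀`, relative to the set `Ω`. -/
def TouchesFromAbove {n : ℕ} (Ω : Set (EuclideanSpace ℝ (Fin n)))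
    (ψ u : EuclideanSpace ℝ (Fin n) → ℝ) (x₀ : EuclideanSpace ℝ (Fin n)) : Prop :=
  u x₀ = ψ x₀ ∧ ∀ x ∈ Ω, x ≠ x₀ → u x < ψ x

/-- `Δ_∞ v ≤ F` in `Ω` in the viscosity sense, for a real-valued function `v` on the open
set `Ω`. -/
def IsViscositySupersolution {n : ℕ} (Ω : Set (EuclideanSpace ℝ (Fin n)))
    (F v : EuclideanSpace ℝ (Fin n) → ℝ) : Prop :=
  LowerSemicontinuousOn v Ω ∧
    ∀ x₀ ∈ Ω, ∀ φ : EuclideanSpace ℝ (Fin n) → ℝ, ContDiffOn ℝ 2 φ Ω →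
      TouchesFromBelow Ω φ v x₀ → infinityLaplacian φ x₀ ≤ F x₀

/-- `Δ_∞ u ≥ F` in `Ω` in the viscosity sense, for a real-valued function `u` on the open
set `Ω`. -/
def IsViscositySubsolution {n : ℕ} (Ω : Set (EuclideanSpace ℝ (Fin n)))
    (F u : EuclideanSpace ℝ (Fin n) → ℝ) : Prop :=
  UpperSemicontinuousOn u Ω ∧
    ∀ x₀ ∈ Ω, ∀ ψ : EuclideanSpace ℝ (Fin n) → ℝ, ContDiffOn ℝ 2 ψ Ω →
      TouchesFromAbove Ω ψ u x₀ → F x₀ ≤ infinityLaplacian ψ x₀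

open Filter Topology Metric Set

/-! Suppose `F > 0` and `u > v` somewhere. As `Δ_∞` is homogeneous of degree 3, `l u` with `l > 1`
near 1 has the strictly larger right-hand side `l³ F`. Let `M(r)`, `W(r)` be the maxima of `u`, `-v`
over the ball of radius `r` about `x₀`, where `x₀` maximizes `l M(ε) + W(ε)`. A midpoint argument
(`ballMax_balance`) puts `A(t) = l (M(ε+t) - M(ε))` below `C(t) = W(ε) - W(ε-t)`, with contact at `t
= 0`.

Radial test functions (`ballMax_isLocalMax`) reduce the PDE to one variable: against increasing
quadratics, `A'² A'' ≥ c` and `C'² C'' ≤ g` with `g < c`. In `false_of_contact` the tests `b t + k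
t²/(2b²)`, `g < k < c`, contradict this: for each slope `b` the test must end below `A` or above `C`
on the right, yet its end value varies continuously from one side to the other. The case `F < 0`
follows by passing to `-v`, `-u`, `-F`. -/

/-! ### Calculus of the `∞`-Laplacian -/

theorem infinityLaplacian_eq_of_fderiv {n : ℕ} {φ ψ : EuclideanSpace ℝ (Fin n) → ℝ}
    {x : EuclideanSpace ℝ (Fin n)} (h₁ : fderiv ℝ φ x = fderiv ℝ ψ x)
    (h₂ : fderiv ℝ (fderiv ℝ φ) x = fderiv ℝ (fderiv ℝ ψ) x) :
    infinityLaplacian φ x = infinityLaplacian ψ x := by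
  simp only [infinityLaplacian, h₁, h₂]

theorem infinityLaplacian_congr {n : ℕ} {φ ψ : EuclideanSpace ℝ (Fin n) → ℝ}
    {x : EuclideanSpace ℝ (Fin n)} (h : φ =ᶠ[𝓝 x] ψ) :
    infinityLaplacian φ x = infinityLaplacian ψ x :=
  infinityLaplacian_eq_of_fderiv h.fderiv_eq h.fderiv.fderiv_eq

theorem infinityLaplacian_neg {n : ℕ} (φ : EuclideanSpace ℝ (Fin n) → ℝ)
    (x : EuclideanSpace ℝ (Fin n)) :
    infinityLaplacian (fun y => -φ y) x = -infinityLaplacian φ x := by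
  have h : fderiv ℝ (fun y => -φ y) = fun y => -fderiv ℝ φ y := by
    funext y
    exact fderiv_fun_neg
  simp [infinityLaplacian, h, fderiv_fun_neg, Finset.sum_neg_distrib]

/-- The `∞`-Laplacian is the second derivative in the direction of the gradient. -/
theorem infinityLaplacian_eq_apply {n : ℕ} {φ : EuclideanSpace ℝ (Fin n) → ℝ}
    {x p : EuclideanSpace ℝ (Fin n)} (hp : fderiv ℝ φ x = innerSL ℝ p) :
    infinityLaplacian φ x = fderiv ℝ (fderiv ℝ φ) x p p := by
  have hsum : p = ∑ i : Fin n, (p i) • (EuclideanSpace.single i (1 : ℝ)) := by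
    ext j
    simp [Pi.single_apply]
  conv_rhs => rw [hsum]
  simp only [infinityLaplacian, hp, map_sum, map_smul, sum_apply,
    smul_apply, smul_eq_mul, Finset.mul_sum, innerSL_apply_apply,
    EuclideanSpace.inner_single_right]
  rw [Finset.sum_comm]
  refine Finset.sum_congr rfl fun i _ => Finset.sum_congr rfl fun j _ => ?_
  simp
  ring

/-- The quartic has zero first and second derivatives at `z`; it serves to make touching strict. -/
theorem infinityLaplacian_add_norm_pow_four {n : ℕ} {ψ : EuclideanSpace ℝ (Fin n) → ℝ}
    {z : EuclideanSpace ℝ (Fin n)} (hψ : ContDiffAt ℝ 2 ψ z) :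
    infinityLaplacian (fun y => ψ y + (‖y - z‖ ^ 2) ^ 2) z = infinityLaplacian ψ z := by
  have hs : ∀ y, HasFDerivAt (fun y : EuclideanSpace ℝ (Fin n) => ‖y - z‖ ^ 2)
      (2 • innerSL ℝ (y - z)) y := fun y => by
    simpa using ((hasFDerivAt_id y).sub_const z).norm_sq
  have hq : ∀ y, HasFDerivAt (fun y : EuclideanSpace ℝ (Fin n) => (‖y - z‖ ^ 2) ^ 2)
      ((2 * ‖y - z‖ ^ 2) • (2 • innerSL ℝ (y - z))) y := fun y => by
    simpa using (hs y).pow 2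
  have hD : ∀ᶠ y in 𝓝 z, fderiv ℝ (fun y => ψ y + (‖y - z‖ ^ 2) ^ 2) y =
      fderiv ℝ ψ y + (2 * ‖y - z‖ ^ 2) • (2 • innerSL ℝ (y - z)) := by
    filter_upwards [hψ.eventually (by simp)] with y hy
    exact ((hy.differentiableAt (by simp)).hasFDerivAt.add (hq y)).fderiv
  have hψ' : DifferentiableAt ℝ (fderiv ℝ ψ) z :=
    (hψ.fderiv_right (m := 1) (by norm_num)).differentiableAt (by simp)
  have hlin : HasFDerivAt (fun y : EuclideanSpace ℝ (Fin n) => 2 • innerSL ℝ (y - z))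
      (2 • innerSL ℝ) z := by
    exact ((innerSL ℝ : EuclideanSpace ℝ (Fin n) →L[ℝ] _).hasFDerivAt.comp z
      ((hasFDerivAt_id z).sub_const z)).const_smul 2
  have h2 : HasFDerivAt (fun y : EuclideanSpace ℝ (Fin n) =>
      (2 * ‖y - z‖ ^ 2) • (2 • innerSL ℝ (y - z)))
      (0 : EuclideanSpace ℝ (Fin n) →L[ℝ] EuclideanSpace ℝ (Fin n) →L[ℝ] ℝ) z := by
    refine (((hs z).const_mul 2).smul hlin).congr_fderiv ?_
    ext a b
    simp
  refine infinityLaplacian_eq_of_fderiv ?_ ?_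
  · rw [hD.self_of_nhds]; simp
  · rw [EventuallyEq.fderiv_eq hD, (hψ'.hasFDerivAt.fun_add h2).fderiv, add_zero]

theorem infinityLaplacian_radial_quadratic {n : ℕ} {x₀ z : EuclideanSpace ℝ (Fin n)} {r : ℝ}
    (hr : 0 < r) (hz : ‖z - x₀‖ = r) (α β γ : ℝ) :
    infinityLaplacian (fun x => α + β * (‖x - x₀‖ - r) + γ / 2 * (‖x - x₀‖ - r) ^ 2) z
      = β ^ 2 * γ := by
  have hnorm : ∀ x, x ≠ x₀ → HasFDerivAt (fun x : EuclideanSpace ℝ (Fin n) => ‖x - x₀‖)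
      (‖x - x₀‖⁻¹ • innerSL ℝ (x - x₀)) x := by
    intro x hx
    have h0 : ‖x - x₀‖ ^ 2 ≠ 0 := by simpa [sub_eq_zero] using hx
    have h1 : HasFDerivAt (fun y : EuclideanSpace ℝ (Fin n) => ‖y - x₀‖ ^ 2)
      (2 • innerSL ℝ (x - x₀)) x := by
      simpa using ((hasFDerivAt_id x).sub_const x₀).norm_sq
    have h2 := h1.sqrt h0
    simp only [Real.sqrt_sq (norm_nonneg _)] at h2
    refine h2.congr_fderiv ?_
    ext a
    simp only [smul_apply, smul_eq_mul, nsmul_eq_mul]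
    field_simp
    norm_num
  have hzx : z ≠ x₀ := by
    rintro rfl
    simp at hz
    exact hr.ne hz
  have hD : ∀ᶠ x in 𝓝 z, fderiv ℝ (fun x => α + β * (‖x - x₀‖ - r)
      + γ / 2 * (‖x - x₀‖ - r) ^ 2) x
      = ((β + γ * (‖x - x₀‖ - r)) * ‖x - x₀‖⁻¹) • innerSL ℝ (x - x₀) := by
    filter_upwards [isOpen_ne.mem_nhds hzx] with x hx
    have h1 := (hnorm x hx).sub_const r
    have h2 : HasFDerivAt (fun x => (‖x - x₀‖ - r) ^ 2) _ x := h1.pow 2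
    rw [(((h1.const_mul β).const_add α).fun_add (h2.const_mul (γ / 2))).fderiv]
    ext a
    simp
    ring
  have hlin : HasFDerivAt (fun y : EuclideanSpace ℝ (Fin n) => innerSL ℝ (y - x₀))
      (innerSL ℝ) z := by
    exact (innerSL ℝ : EuclideanSpace ℝ (Fin n) →L[ℝ] _).hasFDerivAt.comp z
      ((hasFDerivAt_id z).sub_const x₀)
  have hn : ‖z - x₀‖ ≠ 0 := by rw [hz]; exact hr.ne'
  have hcoef := ((((hnorm z hzx).sub_const r).const_mul γ).const_add β).mul
    ((hasDerivAt_inv hn).comp_hasFDerivAt z (hnorm z hzx))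
  have h2 := (hcoef.smul hlin).congr_of_eventuallyEq hD
  rw [infinityLaplacian_eq_apply (p := (β * r⁻¹) • (z - x₀)), h2.fderiv]
  · have hi : innerSL ℝ (z - x₀) (z - x₀) = r ^ 2 := by
      rw [innerSL_apply_apply, real_inner_self_eq_norm_sq, hz]
    simp only [map_smul, smul_apply, add_apply, ContinuousLinearMap.smulRight_apply, smul_eq_mul,
      hi, hz, Pi.mul_apply, Function.comp_apply]
    field_simp
    ring
  · rw [hD.self_of_nhds, hz]
    simp

/-! ### Viscosity inequalities: local tests and reflection -/

/-- A subsolution may be tested with functions that are `C²` near the point only and touch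
locally, not necessarily strictly. -/
theorem IsViscositySubsolution.le_of_eventually_le {n : ℕ} {Ω : Set (EuclideanSpace ℝ (Fin n))}
    {F u ψ : EuclideanSpace ℝ (Fin n) → ℝ} {z : EuclideanSpace ℝ (Fin n)}
    (hu : IsViscositySubsolution Ω F u) (hbdd : BddAbove (u '' Ω)) (hz : z ∈ Ω)
    (hψ : ContDiffAt ℝ 2 ψ z) (hle : ∀ᶠ y in 𝓝 z, u y ≤ ψ y) (heq : u z = ψ z) :
    F z ≤ infinityLaplacian ψ z := by
  obtain ⟨N, hN⟩ := hbdd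
  obtain ⟨ρ, hρ, hball⟩ := Metric.eventually_nhds_iff.1 (hle.and (hψ.eventually (by simp)))
  let f : ContDiffBump z := ⟨ρ / 4, ρ / 2, by linarith, by linarith⟩
  -- A convex combination of two functions lying strictly above `u` off `z`: the perturbed `ψ` near
  -- `z`, and a constant beyond the bound of `u`.
  let φ : EuclideanSpace ℝ (Fin n) → ℝ := fun y =>
    f y * (ψ y + (‖y - z‖ ^ 2) ^ 2) + (1 - f y) * (N + 1)
  have hφ : φ =ᶠ[𝓝 z] fun y => ψ y + (‖y - z‖ ^ 2) ^ 2 := by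
    filter_upwards [f.eventuallyEq_one] with y hy
    simp [φ, hy]
  rw [← infinityLaplacian_add_norm_pow_four hψ, ← infinityLaplacian_congr hφ]
  refine hu.2 z hz φ (fun y _ => ContDiffAt.contDiffWithinAt ?_) ⟨?_, fun y hy hyz => ?_⟩
  · by_cases hy : dist y z < ρ
    · have h1 : ContDiffAt ℝ 2 (fun y => ‖y - z‖ ^ 2) y :=
        (contDiffAt_id.sub contDiffAt_const).norm_sq ℝ
      exact (f.contDiffAt.mul ((hball hy).2.add (h1.pow 2))).add
        ((contDiffAt_const.sub f.contDiffAt).mul contDiffAt_const)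
    · have : φ =ᶠ[𝓝 y] fun _ => N + 1 := by
        have hy' : y ∈ {x | ρ / 2 < dist x z} := by
          simp only [mem_ofPred_eq]
          linarith
        filter_upwards [(isOpen_lt continuous_const (by fun_prop)).mem_nhds hy'] with x hx
        have : f x = 0 := f.zero_of_le_dist (le_of_lt hx)
        simp [φ, this]
      exact contDiffAt_const.congr_of_eventuallyEq this
  · rw [hφ.self_of_nhds, heq]
    simp
  · have huN : u y < N + 1 := by linarith [hN (mem_image_of_mem u hy)]
    by_cases hyρ : dist y z < ρ / 2
    · have hf : 0 < f y := f.pos_of_mem_ball hyρ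
      have hf1 : f y ≤ 1 := f.le_one
      have hq : 0 < (‖y - z‖ ^ 2) ^ 2 := by
        have : 0 < ‖y - z‖ := norm_pos_iff.2 (sub_ne_zero.2 hyz)
        positivity
      have huψ := (hball (show dist y z < ρ by linarith)).1
      have h1 : f y * u y < f y * (ψ y + (‖y - z‖ ^ 2) ^ 2) :=
        mul_lt_mul_of_pos_left (by linarith) hf
      have h2 : (1 - f y) * u y ≤ (1 - f y) * (N + 1) :=
        mul_le_mul_of_nonneg_left huN.le (by linarith)
      simp only [φ]
      linarith
    · have : f y = 0 := f.zero_of_le_dist (not_lt.1 hyρ)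
      simpa [φ, this] using huN

theorem IsViscositySupersolution.neg {n : ℕ} {Ω : Set (EuclideanSpace ℝ (Fin n))}
    {F v : EuclideanSpace ℝ (Fin n) → ℝ} (hv : IsViscositySupersolution Ω F v) :
    IsViscositySubsolution Ω (fun x => -F x) (fun x => -v x) := by
  refine ⟨fun x hx a ha => ?_, fun x₀ hx₀ ψ hψ ht => ?_⟩
  · filter_upwards [hv.1 x hx (-a) (by linarith)] with y hy
    linarith
  · have := hv.2 x₀ hx₀ (fun x => -ψ x) hψ.neg
      ⟨by linarith [ht.1], fun x hx hne => by linarith [ht.2 x hx hne]⟩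
    rw [infinityLaplacian_neg] at this
    linarith

theorem IsViscositySubsolution.neg {n : ℕ} {Ω : Set (EuclideanSpace ℝ (Fin n))}
    {F u : EuclideanSpace ℝ (Fin n) → ℝ} (hu : IsViscositySubsolution Ω F u) :
    IsViscositySupersolution Ω (fun x => -F x) (fun x => -u x) := by
  refine ⟨fun x hx a ha => ?_, fun x₀ hx₀ φ hφ ht => ?_⟩
  · filter_upwards [hu.1 x hx (-a) (by linarith)] with y hy
    linarith
  · have := hu.2 x₀ hx₀ (fun x => -φ x) hφ.neg
      ⟨by linarith [ht.1], fun x hx hne => by linarith [ht.2 x hx hne]⟩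
    rw [infinityLaplacian_neg] at this
    linarith

theorem IsViscositySubsolution.congr {n : ℕ} {Ω : Set (EuclideanSpace ℝ (Fin n))}
    {F u w : EuclideanSpace ℝ (Fin n) → ℝ} (hu : IsViscositySubsolution Ω F u)
    (h : EqOn w u Ω) : IsViscositySubsolution Ω F w := by
  refine ⟨fun x hx a ha => ?_, fun x₀ hx₀ ψ hψ ht => hu.2 x₀ hx₀ ψ hψ
    ⟨(h hx₀) ▸ ht.1, fun x hx hne => (h hx) ▸ ht.2 x hx hne⟩⟩
  filter_upwards [hu.1 x hx a ((h hx).symm.trans_lt ha), self_mem_nhdsWithin] with y hy hyΩ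
  rwa [h hyΩ]

/-! ### Maxima over concentric balls -/

/-- The maximum of `u` over the closed ball of radius `r ≥ 0` about `x₀`. -/
noncomputable def ballMax {n : ℕ} (u : EuclideanSpace ℝ (Fin n) → ℝ)
    (x₀ : EuclideanSpace ℝ (Fin n)) (r : ℝ) : ℝ :=
  sSup ((fun y => u (x₀ + r • y)) '' closedBall 0 1)

section ballMax

variable {n : ℕ} {u : EuclideanSpace ℝ (Fin n) → ℝ} {x₀ x : EuclideanSpace ℝ (Fin n)} {r : ℝ}

theorem continuous_ballMax (hu : Continuous u) : Continuous (ballMax u x₀) :=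
  (isCompact_closedBall 0 1).continuous_sSup (by fun_prop)

theorem le_ballMax (hu : Continuous u) (hx : ‖x - x₀‖ ≤ r) : u x ≤ ballMax u x₀ r := by
  refine le_csSup ((isCompact_closedBall 0 1).image (by fun_prop)).bddAbove ?_
  rcases (le_trans (norm_nonneg _) hx).eq_or_lt with hr | hr
  · refine ⟨0, by simp, ?_⟩
    have : x = x₀ := by
      rw [← hr] at hx
      simpa [sub_eq_zero] using hx
    simp [this]
  · refine ⟨r⁻¹ • (x - x₀), ?_, ?_⟩
    · rw [mem_closedBall_zero_iff, norm_smul, Real.norm_of_nonneg (by positivity)]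
      field_simp
      exact hx
    · simp [smul_smul, hr.ne']

theorem exists_eq_ballMax (hu : Continuous u) (hr : 0 ≤ r) :
    ∃ x, ‖x - x₀‖ ≤ r ∧ u x = ballMax u x₀ r := by
  obtain ⟨y, hy, h⟩ := (isCompact_closedBall (0 : EuclideanSpace ℝ (Fin n)) 1).exists_sSup_image_eq
    ⟨0, by simp⟩ (f := fun y => u (x₀ + r • y)) (by fun_prop)
  refine ⟨x₀ + r • y, ?_, h.symm⟩
  rw [mem_closedBall_zero_iff] at hy
  rw [add_sub_cancel_left, norm_smul, Real.norm_of_nonneg hr]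
  exact mul_le_of_le_one_right hr hy

theorem ballMax_mono (hu : Continuous u) {s : ℝ} (hs : 0 ≤ s) (hsr : s ≤ r) :
    ballMax u x₀ s ≤ ballMax u x₀ r := by
  obtain ⟨x, hx, h⟩ := exists_eq_ballMax (x₀ := x₀) hu hs
  exact h ▸ le_ballMax hu (hx.trans hsr)

/-- `ballMax u x₀` is a subsolution of the one-dimensional equation, tested with increasing
quadratic functions. -/
theorem IsViscositySubsolution.ballMax_isLocalMax {Ω : Set (EuclideanSpace ℝ (Fin n))}
    {F : EuclideanSpace ℝ (Fin n) → ℝ} (hsub : IsViscositySubsolution Ω F u)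
    (hbdd : BddAbove (u '' Ω)) (hu : Continuous u) (hr : 0 < r) (hball : closedBall x₀ r ⊆ Ω)
    {β γ : ℝ} (hβ : 0 < β)
    (hmax : IsLocalMax (fun s => ballMax u x₀ s - (β * (s - r) + γ / 2 * (s - r) ^ 2)) r) :
    ∃ x ∈ closedBall x₀ r, F x ≤ β ^ 2 * γ := by
  obtain ⟨x, hx, hux⟩ := exists_eq_ballMax (x₀ := x₀) hu hr.le
  have hxb : x ∈ closedBall x₀ r := by rwa [mem_closedBall, dist_eq_norm]
  -- An interior maximum point would keep `ballMax` constant just below `r`, while the test function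
  -- increases strictly there.
  have hxr : ‖x - x₀‖ = r := by
    refine hx.antisymm (not_lt.1 fun hlt => ?_)
    have hd : HasDerivAt (fun s => β * (s - r) + γ / 2 * (s - r) ^ 2) β r := by
      have h1 := (hasDerivAt_id r).sub_const r
      have := (h1.const_mul β).fun_add ((h1.pow 2).const_mul (γ / 2))
      simpa using this
    have h1 : ∀ᶠ s in 𝓝[<] r, β * (s - r) + γ / 2 * (s - r) ^ 2 < 0 := by
      have h := (hasDerivAt_iff_tendsto_slope.1 hd).mono_left
        (nhdsWithin_mono r fun s (hs : s < r) => hs.ne)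
      filter_upwards [h.eventually (lt_mem_nhds hβ), self_mem_nhdsWithin] with s hs hsr
      have hsr' : s - r < 0 := sub_neg.2 hsr
      simp only [slope_def_field, sub_self, mul_zero, zero_pow two_ne_zero, add_zero,
        sub_zero] at hs
      by_contra hcon
      exact absurd hs (not_lt.2 (div_nonpos_of_nonneg_of_nonpos (not_lt.1 hcon) hsr'.le))
    have h2 : ∀ᶠ s in 𝓝[<] r, ‖x - x₀‖ < s := nhdsWithin_le_nhds (lt_mem_nhds hlt)
    obtain ⟨s, hs1, hs2, hs3⟩ := (h1.and (h2.and (nhdsWithin_le_nhds hmax))).exists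
    have := le_ballMax hu hs2.le
    simp only [sub_self, mul_zero, zero_pow two_ne_zero, add_zero] at hs3
    linarith
  refine ⟨x, hxb, ?_⟩
  rw [← infinityLaplacian_radial_quadratic hr hxr (u x) β γ]
  refine hsub.le_of_eventually_le hbdd (hball hxb) ?_ ?_ (by simp [hxr])
  · have hne : x - x₀ ≠ 0 := by
      intro h
      rw [h, norm_zero] at hxr
      exact hr.ne hxr
    have h1 : ContDiffAt ℝ 2 (fun y => ‖y - x₀‖ - r) x :=
      ((contDiffAt_norm ℝ hne).comp x (contDiffAt_id.sub contDiffAt_const)).sub contDiffAt_const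
    exact (contDiffAt_const.add (contDiffAt_const.mul h1)).add (contDiffAt_const.mul (h1.pow 2))
  · have hc : Tendsto (fun y : EuclideanSpace ℝ (Fin n) => ‖y - x₀‖) (𝓝 x) (𝓝 r) := by
      rw [← hxr]
      exact Continuous.tendsto (by fun_prop) x
    filter_upwards [hc.eventually hmax] with y hy
    have := le_ballMax hu (le_refl ‖y - x₀‖)
    simp only [sub_self, mul_zero, zero_pow two_ne_zero, add_zero] at hy
    linarith

theorem infinityLaplacian_const (c : ℝ) : infinityLaplacian (fun _ => c) x = 0 := by
  simp [infinityLaplacian]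

/-- Otherwise a constant touches `u` from above at `x₀`, forcing `F x₀ ≤ 0`. -/
theorem IsViscositySubsolution.lt_ballMax {Ω : Set (EuclideanSpace ℝ (Fin n))}
    {F : EuclideanSpace ℝ (Fin n) → ℝ} (hsub : IsViscositySubsolution Ω F u)
    (hbdd : BddAbove (u '' Ω)) (hu : Continuous u) (hr : 0 < r) (hx₀ : x₀ ∈ Ω)
    (hF : 0 < F x₀) : ballMax u x₀ 0 < ballMax u x₀ r := by
  refine (ballMax_mono hu le_rfl hr.le).lt_of_ne fun heq => ?_
  have h := hsub.le_of_eventually_le (ψ := fun _ => u x₀) hbdd hx₀ contDiffAt_const ?_ rfl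
  · rw [infinityLaplacian_const] at h
    exact absurd hF (not_lt.2 h)
  · filter_upwards [ball_mem_nhds x₀ hr] with y hy
    obtain ⟨x, hx, hux⟩ := exists_eq_ballMax (x₀ := x₀) hu le_rfl
    have hxx : x = x₀ := by simpa [sub_eq_zero] using hx
    rw [← hxx, hux, heq]
    exact le_ballMax hu (by rw [← dist_eq_norm]; exact (mem_ball.1 hy).le)

end ballMax

/-! ### One-dimensional comparison -/

theorem lt_endpoint_of_not_isLocalMax {f : ℝ → ℝ} {a b c : ℝ} (hc : c ∈ Ioo a b)
    (hf : ContinuousOn f (Icc a b)) (h : ∀ t ∈ Ioo a b, ¬ IsLocalMax f t) :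
    f c < f a ∨ f c < f b := by
  obtain ⟨t, ht, hmax⟩ := isCompact_Icc.exists_isMaxOn ⟨c, Ioo_subset_Icc_self hc⟩ hf
  have key : ∀ s ∈ Ioo a b, f s ≠ f t := fun s hs hst => h s hs <| by
    filter_upwards [isOpen_Ioo.mem_nhds hs] with y hy
    exact hst ▸ hmax (Ioo_subset_Icc_self hy)
  have hct : f c < f t := (hmax (Ioo_subset_Icc_self hc)).lt_of_ne (key c hc)
  rcases ht.1.eq_or_lt with rfl | h1
  · exact Or.inl hct
  rcases ht.2.eq_or_lt with rfl | h2
  · exact Or.inr hct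
  · exact absurd rfl (key t ⟨h1, h2⟩)

/-- A one-dimensional strict comparison principle at a contact point: the test functions
`t ↦ b t + k t² / (2 b²)` cannot separate `A` from `C` in a way that depends continuously on `b`. -/
theorem false_of_contact {A C : ℝ → ℝ} {τ k b₀ b₁ : ℝ} (hA : Continuous A) (hC : Continuous C)
    (hA0 : A 0 = 0) (hC0 : C 0 = 0) (hAC : ∀ t ∈ Icc (-τ) τ, A t ≤ C t) (hτ : 0 < τ)
    (hb₀ : 0 < b₀) (hb : b₀ ≤ b₁)
    (hAmax : ∀ b ∈ Icc b₀ b₁, ∀ t ∈ Ioo (-τ) τ,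
      ¬ IsLocalMax (fun t => A t - (b * t + k / (2 * b ^ 2) * t ^ 2)) t)
    (hCmin : ∀ b ∈ Icc b₀ b₁, ∀ t ∈ Ioo (-τ) τ,
      ¬ IsLocalMax (fun t => (b * t + k / (2 * b ^ 2) * t ^ 2) - C t) t)
    (h₀ : b₀ * τ + k / (2 * b₀ ^ 2) * τ ^ 2 < A τ)
    (h₁ : C τ < b₁ * τ + k / (2 * b₁ ^ 2) * τ ^ 2) : False := by
  have hGc : ContinuousOn (fun b => b * τ + k / (2 * b ^ 2) * τ ^ 2) (Icc b₀ b₁) := by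
    refine (by fun_prop : Continuous fun b : ℝ => b * τ).continuousOn.add
      ((continuousOn_const.div (by fun_prop) fun b hb => ?_).mul continuousOn_const)
    have : 0 < b := hb₀.trans_le hb.1
    positivity
  have hcover : ∀ b ∈ Icc b₀ b₁, b * τ + k / (2 * b ^ 2) * τ ^ 2 < A τ ∨
      C τ < b * τ + k / (2 * b ^ 2) * τ ^ 2 := by
    intro b hb
    have h0 : (0 : ℝ) ∈ Ioo (-τ) τ := ⟨by linarith, hτ⟩
    have hA' := lt_endpoint_of_not_isLocalMax h0 (by fun_prop) (hAmax b hb)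
    have hC' := lt_endpoint_of_not_isLocalMax h0 (by fun_prop) (hCmin b hb)
    have h1 := hAC (-τ) ⟨le_rfl, by linarith⟩
    simp only [hA0, hC0] at hA' hC'
    ring_nf at hA' hC' ⊢
    -- Both escapes at `-τ` would put the test below `A` and above `C` there, against `A ≤ C`.
    rcases hA' with hA' | hA'
    · rcases hC' with hC' | hC'
      · linarith
      · exact Or.inr (by linarith)
    · exact Or.inl (by linarith)
  have hτAC := hAC τ ⟨by linarith, le_rfl⟩
  obtain ⟨b, hbm, hbe⟩ := intermediate_value_Icc hb hGc
    (show (A τ + C τ) / 2 ∈ Icc _ _ from ⟨by linarith, by linarith⟩)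
  have hbe' : b * τ + k / (2 * b ^ 2) * τ ^ 2 = (A τ + C τ) / 2 := hbe
  rcases hcover b hbm with h | h <;> linarith

/-- With `y = k t / b³`, the quantity `(1 + y)² k` is slope squared times second derivative of the
test function at `t`. -/
theorem slope_bounds {k g c y : ℝ} (hg : 0 < g) (hgc : g < c) (hk : k = (g + c) / 2)
    (hy : |y| ≤ (c - g) / (12 * k)) : 0 < 1 + y ∧ g < (1 + y) ^ 2 * k ∧ (1 + y) ^ 2 * k < c := by
  have hk0 : 0 < k := by linarith
  have h1 : (c - g) / (12 * k) < 1 / 6 := by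
    rw [div_lt_div_iff₀ (by positivity) (by norm_num)]
    linarith
  have h2 : |y| * k ≤ (c - g) / 12 := by
    have := mul_le_mul_of_nonneg_right hy hk0.le
    rwa [div_mul_eq_mul_div, mul_div_mul_right _ _ hk0.ne'] at this
  obtain ⟨h3, h4⟩ := abs_le.1 (hy.trans h1.le)
  have h5 : y * k ≤ (c - g) / 12 := (mul_le_mul_of_nonneg_right (le_abs_self y) hk0.le).trans h2
  have h6 : -((c - g) / 12) ≤ y * k := by
    have := mul_le_mul_of_nonneg_right (neg_abs_le y) hk0.le
    linarith
  have h7 : y ^ 2 * k ≤ (c - g) / 12 := by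
    have : y ^ 2 ≤ |y| := by
      rw [← sq_abs]
      nlinarith [abs_nonneg y]
    exact (mul_le_mul_of_nonneg_right this hk0.le).trans h2
  have h8 : 0 ≤ y ^ 2 * k := by positivity
  refine ⟨by linarith, ?_, ?_⟩ <;> nlinarith

/-! ### Comparison for right-hand sides with a positive lower bound -/

section Comparison

variable {n : ℕ} {Ω : Set (EuclideanSpace ℝ (Fin n))} {F u v : EuclideanSpace ℝ (Fin n) → ℝ}

/-- The maxima of `l u` and of `-v` over concentric balls cannot balance to first order at a
maximum point of the difference of the regularizations when the right-hand sides are strictly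
ordered. -/
theorem false_of_ballMax_balance (hsub : IsViscositySubsolution Ω F u)
    (hsup : IsViscositySupersolution Ω F v) (hubd : BddAbove (u '' Ω))
    (hvbd : BddAbove ((fun x => -v x) '' Ω)) (hu : Continuous u) (hv : Continuous v)
    {x₀ : EuclideanSpace ℝ (Fin n)} {ε l g c : ℝ} (hε : 0 < ε) (hl : 0 < l)
    (hball : closedBall x₀ (2 * ε) ⊆ Ω) (hg : 0 < g) (hgc : g < c)
    (hFpos : ∀ x ∈ closedBall x₀ (2 * ε), 0 < F x)
    (hFg : ∀ x ∈ closedBall x₀ (2 * ε), F x ≤ g)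
    (hFc : ∀ x ∈ closedBall x₀ (2 * ε), c ≤ l ^ 3 * F x)
    (hbal : ∀ t ∈ Icc (-ε) ε, l * ballMax u x₀ (ε + t) + ballMax (fun x => -v x) x₀ (ε - t)
      ≤ l * ballMax u x₀ ε + ballMax (fun x => -v x) x₀ ε) : False := by
  set M := ballMax u x₀ with hM
  set W := ballMax (fun x => -v x) x₀ with hW
  have hMc : Continuous M := continuous_ballMax hu
  have hWc : Continuous W := continuous_ballMax hv.neg
  set A : ℝ → ℝ := fun t => l * (M (ε + t) - M ε) with hA
  set C : ℝ → ℝ := fun t => W ε - W (ε - t) with hC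
  have hAc : Continuous A := by fun_prop
  have hCc : Continuous C := by fun_prop
  have hsubset : ∀ r ≤ 2 * ε, closedBall x₀ r ⊆ closedBall x₀ (2 * ε) :=
    fun r hr => closedBall_subset_closedBall hr
  -- quadratic test functions for `A` and `C`
  have testA : ∀ t ∈ Ioo (-ε) ε, ∀ β γ : ℝ, 0 < β →
      IsLocalMax (fun s => A s - (β * (s - t) + γ / 2 * (s - t) ^ 2)) t →
      ∃ x ∈ closedBall x₀ (2 * ε), l ^ 3 * F x ≤ β ^ 2 * γ := by
    intro t ht β γ hβ hmax
    have hr : 0 < ε + t := by linarith [ht.1]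
    have hr2 : ε + t ≤ 2 * ε := by linarith [ht.2]
    have hsh : Tendsto (fun s => s - ε) (𝓝 (ε + t)) (𝓝 t) :=
      (by fun_prop : Continuous fun s : ℝ => s - ε).tendsto' _ _ (by ring)
    obtain ⟨x, hx, h⟩ := hsub.ballMax_isLocalMax hubd hu hr ((hsubset _ hr2).trans hball)
      (β := β / l) (γ := γ / l) (by positivity) (by
        filter_upwards [hsh.eventually hmax] with s hs
        simp only [hA, add_sub_cancel, sub_self] at hs ⊢
        have e : s - (ε + t) = s - ε - t := by ring
        rw [e]
        refine le_of_mul_le_mul_left ?_ hl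
        have e2 : ∀ m p q : ℝ, l * (m - (β / l * p + γ / l / 2 * q)) =
          l * m - (β * p + γ / 2 * q) := fun m p q => by field_simp
        rw [e2, e2]
        linarith)
    refine ⟨x, hsubset _ hr2 hx, ?_⟩
    calc l ^ 3 * F x ≤ l ^ 3 * ((β / l) ^ 2 * (γ / l)) := by gcongr
      _ = β ^ 2 * γ := by field_simp
  have testC : ∀ t ∈ Ioo (-ε) ε, ∀ β γ : ℝ, 0 < β →
      IsLocalMax (fun s => (β * (s - t) + γ / 2 * (s - t) ^ 2) - C s) t →
      ∃ x ∈ closedBall x₀ (2 * ε), β ^ 2 * γ ≤ F x := by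
    intro t ht β γ hβ hmax
    have hr : 0 < ε - t := by linarith [ht.2]
    have hr2 : ε - t ≤ 2 * ε := by linarith [ht.1]
    have hsh : Tendsto (fun s => ε - s) (𝓝 (ε - t)) (𝓝 t) :=
      (by fun_prop : Continuous fun s : ℝ => ε - s).tendsto' _ _ (by ring)
    obtain ⟨x, hx, h⟩ := hsup.neg.ballMax_isLocalMax hvbd hv.neg hr ((hsubset _ hr2).trans hball)
      (β := β) (γ := -γ) hβ (by
        filter_upwards [hsh.eventually hmax] with s hs
        simp only [hC, sub_sub_cancel, sub_self] at hs ⊢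
        have e : s - (ε - t) = -(ε - s - t) := by ring
        rw [e]
        linarith)
    exact ⟨x, hsubset _ hr2 hx, by linarith⟩
  -- `A` has positive slope at `0`
  have hx₀ : x₀ ∈ closedBall x₀ (2 * ε) := mem_closedBall_self (by positivity)
  have hM0 : M 0 < M ε := hsub.lt_ballMax hubd hu hε (hball hx₀) (hFpos x₀ hx₀)
  -- Half the chord slope of `A` over `[-ε, 0]`, so `A r - s r` is strictly smaller at `-ε` than at
  -- `0`. Linear tests of slope `s` would give `l³ F ≤ 0`, so the function must exceed its value at
  -- `0` further right.
  set s := l * (M ε - M 0) / (2 * ε) with hs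
  have hs0 : 0 < s := div_pos (mul_pos hl (sub_pos.2 hM0)) (by positivity)
  have hslope : ∀ t ∈ Ioo 0 ε, s * t ≤ A t := by
    intro t ht
    have hno : ∀ r ∈ Ioo (-ε) t, ¬ IsLocalMax (fun r => A r - s * r) r := by
      intro r hr hmax
      obtain ⟨x, hx, h⟩ := testA r ⟨hr.1, hr.2.trans ht.2⟩ s 0 hs0 (by
        filter_upwards [hmax] with q hq
        linarith)
      have := mul_pos (pow_pos hl 3) (hFpos x hx)
      linarith
    have h := lt_endpoint_of_not_isLocalMax (c := 0) ⟨by linarith, ht.1⟩ (by fun_prop) hno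
    have hA0 : A (-ε) = -(2 * ε * s) := by
      simp only [hA, hs, add_neg_cancel]
      field_simp
      ring
    have h00 : A 0 = 0 := by simp [hA]
    rcases h with h | h
    · simp only [h00, hA0] at h
      have := mul_pos hε hs0
      linarith
    · simp only [h00] at h
      linarith
  set k := (g + c) / 2 with hk
  have hk0 : 0 < k := by linarith
  set b₀ := s / 2 with hb₀
  have hb₀0 : 0 < b₀ := by positivity
  -- The lower bound `b₀` on slopes makes one `τ` work for all `b ≥ b₀` in `slope_bounds`.
  obtain ⟨τ, hτ0, hτε, hτ⟩ : ∃ τ, 0 < τ ∧ τ < ε ∧ k * τ / b₀ ^ 3 ≤ (c - g) / (12 * k) := by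
    have hq : 0 < (c - g) / (12 * k) * b₀ ^ 3 / k := by
      have := sub_pos.2 hgc
      positivity
    refine ⟨min (ε / 2) ((c - g) / (12 * k) * b₀ ^ 3 / k), lt_min (by positivity) hq,
      (min_le_left _ _).trans_lt (by linarith), ?_⟩
    rw [div_le_iff₀ (by positivity)]
    calc _ ≤ k * ((c - g) / (12 * k) * b₀ ^ 3 / k) := by gcongr; exact min_le_right _ _
      _ = _ := by field_simp
  have hyb : ∀ b, b₀ ≤ b → ∀ t ∈ Ioo (-τ) τ, |k * t / b ^ 3| ≤ (c - g) / (12 * k) := by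
    intro b hb t ht
    have hb0 := hb₀0.trans_le hb
    refine le_trans ?_ hτ
    rw [abs_div, abs_mul, abs_of_pos hk0, abs_of_pos (pow_pos hb0 3)]
    gcongr
    exact (abs_lt.2 ht).le
  -- the value and slope of the test function at `t`
  have hexp : ∀ b, 0 < b → ∀ t q : ℝ, b * q + k / (2 * b ^ 2) * q ^ 2 =
      (b * t + k / (2 * b ^ 2) * t ^ 2) +
        (b * (1 + k * t / b ^ 3) * (q - t) + k / b ^ 2 / 2 * (q - t) ^ 2) := by
    intro b hb t q
    field_simp
    ring
  have hval : ∀ b, 0 < b → ∀ t, (b * (1 + k * t / b ^ 3)) ^ 2 * (k / b ^ 2) =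
      (1 + k * t / b ^ 3) ^ 2 * k := by
    intro b hb t
    field_simp
  refine false_of_contact (τ := τ) (k := k) (b₀ := b₀) (b₁ := max b₀ (C τ / τ)) hAc hCc
    (by simp [hA]) (by simp [hC]) ?_ hτ0 hb₀0 (le_max_left _ _) ?_ ?_ ?_ ?_
  · intro t ht
    have := hbal t ⟨by linarith [ht.1], by linarith [ht.2]⟩
    simp only [hA, hC]
    linarith
  · intro b hb t ht hmax
    have hb0 := hb₀0.trans_le hb.1
    obtain ⟨h1, -, h3⟩ := slope_bounds hg hgc hk (hyb b hb.1 t ht)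
    obtain ⟨x, hx, h⟩ := testA t ⟨by linarith [ht.1], by linarith [ht.2]⟩ _ (k / b ^ 2)
      (mul_pos hb0 h1) (by
        filter_upwards [hmax] with q hq
        simp only [hexp b hb0 t q, sub_self] at hq ⊢
        linarith)
    rw [hval b hb0] at h
    linarith [hFc x hx]
  · intro b hb t ht hmax
    have hb0 := hb₀0.trans_le hb.1
    obtain ⟨h1, h2, -⟩ := slope_bounds hg hgc hk (hyb b hb.1 t ht)
    obtain ⟨x, hx, h⟩ := testC t ⟨by linarith [ht.1], by linarith [ht.2]⟩ _ (k / b ^ 2)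
      (mul_pos hb0 h1) (by
        filter_upwards [hmax] with q hq
        simp only [hexp b hb0 t q, sub_self] at hq ⊢
        linarith)
    rw [hval b hb0] at h
    linarith [hFg x hx]
  · refine lt_of_lt_of_le ?_ (hslope τ ⟨hτ0, hτε⟩)
    have h1 : (c - g) / (12 * k) < 1 := by
      rw [div_lt_one (by positivity)]
      linarith
    have h2 : k * τ < b₀ ^ 3 := by
      have := hτ.trans_lt h1
      rwa [div_lt_one (by positivity)] at this
    have h3 : k / (2 * b₀ ^ 2) * τ ^ 2 = k * τ * (τ / (2 * b₀ ^ 2)) := by ring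
    have h4 : b₀ ^ 3 * (τ / (2 * b₀ ^ 2)) = b₀ * τ / 2 := by field_simp
    have h5 : k * τ * (τ / (2 * b₀ ^ 2)) < b₀ ^ 3 * (τ / (2 * b₀ ^ 2)) :=
      mul_lt_mul_of_pos_right h2 (by positivity)
    have h6 : s = 2 * b₀ := by rw [hb₀]; ring
    rw [h6, h3]
    have := mul_pos hb₀0 hτ0
    linarith
  · set b := max b₀ (C τ / τ)
    have hb : 0 < b := hb₀0.trans_le (le_max_left _ _)
    have h1 : C τ ≤ b * τ := (div_le_iff₀ hτ0).1 (le_max_right _ _)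
    have : 0 < k / (2 * b ^ 2) * τ ^ 2 := by positivity
    linarith

theorem continuous_ballMax_center (hu : Continuous u) (r : ℝ) :
    Continuous fun x₀ => ballMax u x₀ r :=
  (isCompact_closedBall 0 1).continuous_sSup
    (f := fun (x₀ : EuclideanSpace ℝ (Fin n)) y => u (x₀ + r • y)) (by fun_prop)

/-- At a maximum point `x₀` of the difference of the regularizations at scale `ε`, enlarging one
ball and shrinking the other does not increase the difference. -/
theorem ballMax_balance {w₁ w₂ : EuclideanSpace ℝ (Fin n) → ℝ} (h₁ : Continuous w₁)
    (h₂ : Continuous w₂) {x₀ : EuclideanSpace ℝ (Fin n)} {ε l t : ℝ} (hl : 0 ≤ l)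
    (hmax : ∀ z ∈ closedBall x₀ ε,
      l * ballMax w₁ z ε + ballMax w₂ z ε ≤ l * ballMax w₁ x₀ ε + ballMax w₂ x₀ ε)
    (ht : t ∈ Icc (-ε) ε) :
    l * ballMax w₁ x₀ (ε + t) + ballMax w₂ x₀ (ε - t) ≤
      l * ballMax w₁ x₀ ε + ballMax w₂ x₀ ε := by
  obtain ⟨x, hx, hx'⟩ := exists_eq_ballMax (x₀ := x₀) h₁ (by linarith [ht.1] : 0 ≤ ε + t)
  obtain ⟨y, hy, hy'⟩ := exists_eq_ballMax (x₀ := x₀) h₂ (by linarith [ht.2] : 0 ≤ ε - t)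
  have half : ∀ w : EuclideanSpace ℝ (Fin n), ‖w‖ ≤ 2 * ε → ‖(2⁻¹ : ℝ) • w‖ ≤ ε := by
    intro w hw
    rw [norm_smul, Real.norm_of_nonneg (by norm_num)]
    linarith
  have hxy : ‖x - y‖ ≤ 2 * ε := by
    have := norm_sub_le (x - x₀) (y - x₀)
    rw [sub_sub_sub_cancel_right] at this
    linarith
  -- The radii `ε + t` and `ε - t` average to `ε`, so the midpoint is within `ε` of `x₀`, of `x` and
  -- of `y`.
  have hz₀ : (2⁻¹ : ℝ) • (x + y) ∈ closedBall x₀ ε := by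
    rw [mem_closedBall, dist_eq_norm]
    have e : (2⁻¹ : ℝ) • (x + y) - x₀ = (2⁻¹ : ℝ) • ((x - x₀) + (y - x₀)) := by module
    rw [e]
    exact half _ ((norm_add_le _ _).trans (by linarith))
  have hzx : ‖x - (2⁻¹ : ℝ) • (x + y)‖ ≤ ε := by
    have e : x - (2⁻¹ : ℝ) • (x + y) = (2⁻¹ : ℝ) • (x - y) := by module
    exact e ▸ half _ hxy
  have hzy : ‖y - (2⁻¹ : ℝ) • (x + y)‖ ≤ ε := by
    have e : y - (2⁻¹ : ℝ) • (x + y) = (2⁻¹ : ℝ) • (y - x) := by module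
    exact e ▸ half _ (norm_sub_rev x y ▸ hxy)
  rw [← hx', ← hy']
  refine le_trans ?_ (hmax _ hz₀)
  gcongr
  · exact le_ballMax h₁ hzx
  · exact le_ballMax h₂ hzy

theorem comparison_of_pos (hΩ : IsOpen Ω) (hbd : Bornology.IsBounded Ω)
    (hu : Continuous u) (hv : Continuous v) (hF : ContinuousOn F Ω) {c₀ : ℝ} (hc₀ : 0 < c₀)
    (hFc : ∀ x ∈ Ω, c₀ ≤ F x) (hsup : IsViscositySupersolution Ω F v)
    (hsub : IsViscositySubsolution Ω F u) (hbdry : ∀ x ∈ frontier Ω, u x ≤ v x) :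
    ∀ x ∈ Ω, u x ≤ v x := by
  intro p hp
  by_contra! hcon
  have hK : IsCompact (closure Ω) := hbd.isCompact_closure
  obtain ⟨B, hB0, hB⟩ : ∃ B > 0, ∀ x ∈ closure Ω, |u x| ≤ B := by
    obtain ⟨B, hB⟩ := hK.exists_bound_of_continuousOn hu.continuousOn
    exact ⟨max B 1, by positivity, fun x hx => (hB x hx).trans (le_max_left _ _)⟩
  -- Then `l u - δ B ≤ u` on the closure, preserving the boundary order, and at `p` the loss is at
  -- most `2 δ B = (u p - v p) / 2`.
  set δ := (u p - v p) / (4 * B) with hδ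
  have hδ0 : 0 < δ := div_pos (sub_pos.2 hcon) (by positivity)
  have hδB : δ * B = (u p - v p) / 4 := by rw [hδ]; field_simp
  set l := 1 + δ with hl
  have hl0 : 0 < l := by positivity
  set h : EuclideanSpace ℝ (Fin n) → ℝ := fun x => l * u x - δ * B - v x with hh
  have hhc : Continuous h := by fun_prop
  set η := h p with hη
  have hη0 : 0 < η := by
    have h1 : -B ≤ u p := (abs_le.1 (hB p (subset_closure hp))).1
    have h2 : δ * -B ≤ δ * u p := by gcongr
    simp only [hη, hh, hl]
    linarith
  have hfr : ∀ x ∈ frontier Ω, h x ≤ 0 := by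
    intro x hx
    have h1 : δ * u x ≤ δ * B := by
      gcongr
      exact (abs_le.1 (hB x (frontier_subset_closure hx))).2
    have := hbdry x hx
    simp only [hh, hl]
    linarith
  set S := closure Ω ∩ {x | η / 2 ≤ h x} with hS
  have hScpt : IsCompact S := hK.inter_right (isClosed_le continuous_const hhc)
  have hSΩ : S ⊆ Ω := by
    rintro x ⟨hxK, hx : η / 2 ≤ h x⟩
    by_contra hxΩ
    have := hfr x (by rw [hΩ.frontier_eq]; exact ⟨hxK, hxΩ⟩)
    linarith
  obtain ⟨ρ, hρ, hρΩ⟩ := hScpt.exists_cthickening_subset_open hΩ hSΩ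
  have hl3 : 1 < l ^ 3 := one_lt_pow₀ (by linarith) (by norm_num)
  -- An oscillation of `F` small enough that `F x₀ + κ < l³ (F x₀ - κ)`.
  set κ := (l ^ 3 - 1) * c₀ / (2 * (1 + l ^ 3)) with hκ
  have hκ0 : 0 < κ := by
    have := sub_pos.2 hl3
    positivity
  have hκ2 : (1 + l ^ 3) * κ = (l ^ 3 - 1) * c₀ / 2 := by rw [hκ]; field_simp
  obtain ⟨d₁, hd₁, hFd⟩ := Metric.uniformContinuousOn_iff.1
    (hScpt.cthickening.uniformContinuousOn_of_continuous (hF.mono hρΩ)) κ hκ0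
  set σ := η / (2 * (l + 1)) with hσ
  have hσ0 : 0 < σ := by positivity
  have hσ2 : (l + 1) * σ = η / 2 := by rw [hσ]; field_simp
  have hK1 : IsCompact (cthickening 1 (closure Ω)) := hK.cthickening
  obtain ⟨d₂, hd₂, hud⟩ := Metric.uniformContinuousOn_iff.1
    (hK1.uniformContinuousOn_of_continuous hu.continuousOn) σ hσ0
  obtain ⟨d₃, hd₃, hvd⟩ := Metric.uniformContinuousOn_iff.1
    (hK1.uniformContinuousOn_of_continuous hv.continuousOn) σ hσ0
  obtain ⟨ε, hε, hε1, hερ, hεd₁, hεd₂, hεd₃⟩ : ∃ ε > 0, ε ≤ 1 ∧ 2 * ε ≤ ρ ∧ 2 * ε < d₁ ∧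
      ε < d₂ ∧ ε < d₃ := by
    have hm : 0 < min (min 1 ρ) (min d₁ (min d₂ d₃)) := by positivity
    set m := min (min 1 ρ) (min d₁ (min d₂ d₃)) with hm_def
    have a1 : m ≤ 1 := (min_le_left _ _).trans (min_le_left _ _)
    have a2 : m ≤ ρ := (min_le_left _ _).trans (min_le_right _ _)
    have a3 : m ≤ d₁ := (min_le_right _ _).trans (min_le_left _ _)
    have a4 : m ≤ d₂ := (min_le_right _ _).trans ((min_le_right _ _).trans (min_le_left _ _))
    have a5 : m ≤ d₃ := (min_le_right _ _).trans ((min_le_right _ _).trans (min_le_right _ _))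
    exact ⟨m / 3, by positivity, by linarith, by linarith, by linarith, by linarith, by linarith⟩
  -- a maximum point of the difference of the regularizations
  obtain ⟨x₀, hx₀K, hx₀⟩ := hK.exists_isMaxOn ⟨p, subset_closure hp⟩
    (((continuous_ballMax_center hu ε).const_mul l).add
      (continuous_ballMax_center hv.neg ε)).continuousOn
  have hx₀max : ∀ z ∈ closure Ω, l * ballMax u z ε + ballMax (fun x => -v x) z ε ≤
      l * ballMax u x₀ ε + ballMax (fun x => -v x) x₀ ε := fun z hz => hx₀ hz
  -- The regularized difference at `x₀` is at least that at `p`; undoing the regularization costs at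
  -- most `(l + 1) σ = η / 2`.
  have hx₀S : x₀ ∈ S := by
    refine ⟨hx₀K, ?_⟩
    obtain ⟨x, hx, hx'⟩ := exists_eq_ballMax (x₀ := x₀) hu hε.le
    obtain ⟨y, hy, hy'⟩ := exists_eq_ballMax (u := fun x => -v x) (x₀ := x₀) hv.neg hε.le
    have h1 := hx₀max p (subset_closure hp)
    have h2 : u p ≤ ballMax u p ε := le_ballMax hu (by simpa using hε.le)
    have h3 : -v p ≤ ballMax (fun x => -v x) p ε :=
      le_ballMax (u := fun x => -v x) hv.neg (by simpa using hε.le)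
    have h4 := mul_le_mul_of_nonneg_left h2 hl0.le
    rw [← dist_eq_norm] at hx hy
    have mem : ∀ w, dist w x₀ ≤ ε → w ∈ cthickening 1 (closure Ω) := fun w hw =>
      closedBall_subset_cthickening hx₀K 1 (closedBall_subset_closedBall hε1 hw)
    have h5 := (abs_lt.1 (hud x (mem x hx) x₀ (mem x₀ (by simpa using hε.le))
      (hx.trans_lt hεd₂))).2
    have h6 := (abs_lt.1 (hvd y (mem y hy) x₀ (mem x₀ (by simpa using hε.le))
      (hy.trans_lt hεd₃))).1
    have h7 := mul_le_mul_of_nonneg_left h5.le hl0.le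
    have hη' : η = l * u p - δ * B - v p := rfl
    rw [← hx', ← hy'] at h1
    change η / 2 ≤ l * u x₀ - δ * B - v x₀
    linarith
  have hsubS : closedBall x₀ (2 * ε) ⊆ cthickening ρ S :=
    (closedBall_subset_closedBall hερ).trans (closedBall_subset_cthickening hx₀S ρ)
  have hball : closedBall x₀ (2 * ε) ⊆ Ω := hsubS.trans hρΩ
  have hFnear : ∀ x ∈ closedBall x₀ (2 * ε), |F x - F x₀| < κ := fun x hx =>
    hFd x (hsubS hx) x₀ (hsubS (mem_closedBall_self (by positivity)))
      ((mem_closedBall.1 hx).trans_lt hεd₁)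
  have hF₀ : c₀ ≤ F x₀ := hFc x₀ (hSΩ hx₀S)
  have himg : ∀ w : EuclideanSpace ℝ (Fin n) → ℝ, Continuous w → BddAbove (w '' Ω) :=
    fun w hw => (hK.image hw).bddAbove.mono (image_mono subset_closure)
  refine false_of_ballMax_balance (g := F x₀ + κ) (c := l ^ 3 * (F x₀ - κ)) hsub hsup (himg u hu)
    (himg _ hv.neg) hu hv hε hl0 hball (by linarith) ?_ (fun x hx => hc₀.trans_le (hFc x (hball hx)))
    (fun x hx => ?_) (fun x hx => ?_) fun t ht => ballMax_balance hu hv.neg hl0.le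
      (fun z hz => hx₀max z (subset_closure (hball
        (closedBall_subset_closedBall (by linarith) hz)))) ht
  · have h1 := mul_le_mul_of_nonneg_left hF₀ (sub_pos.2 hl3).le
    have h2 := mul_pos (sub_pos.2 hl3) hc₀
    linarith
  · linarith [(abs_lt.1 (hFnear x hx)).2]
  · gcongr
    linarith [(abs_lt.1 (hFnear x hx)).1]

/-- Tietze extension makes `u` and `v` globally continuous, so that ball maxima are continuous even
across the boundary. -/
theorem comparison_of_pos_of_continuousOn (hΩ : IsOpen Ω) (hbd : Bornology.IsBounded Ω)
    (hu : ContinuousOn u (closure Ω)) (hv : ContinuousOn v (closure Ω)) (hF : ContinuousOn F Ω)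
    {c₀ : ℝ} (hc₀ : 0 < c₀) (hFc : ∀ x ∈ Ω, c₀ ≤ F x) (hsup : IsViscositySupersolution Ω F v)
    (hsub : IsViscositySubsolution Ω F u) (hbdry : ∀ x ∈ frontier Ω, u x ≤ v x) :
    ∀ x ∈ Ω, u x ≤ v x := by
  have ext : ∀ w : EuclideanSpace ℝ (Fin n) → ℝ, ContinuousOn w (closure Ω) →
      ∃ w', Continuous w' ∧ EqOn w' w (closure Ω) := fun w hw => by
    obtain ⟨g, hg⟩ := ContinuousMap.exists_restrict_eq isClosed_closure
      ⟨_, continuousOn_iff_continuous_domRestrict.1 hw⟩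
    exact ⟨g, g.continuous, fun x hx => congrArg (fun f => f ⟨x, hx⟩) hg⟩
  obtain ⟨u', hu', hue⟩ := ext u hu
  obtain ⟨v', hv', hve⟩ := ext v hv
  have hsup' : IsViscositySupersolution Ω F v' := by
    have := (hsup.neg.congr (w := fun x => -v' x)
      fun x hx => congrArg Neg.neg (hve (subset_closure hx))).neg
    simpa only [neg_neg] using this
  intro x hx
  rw [← hue (subset_closure hx), ← hve (subset_closure hx)]
  refine comparison_of_pos hΩ hbd hu' hv' hF hc₀ hFc hsup'
    (hsub.congr (hue.mono subset_closure)) (fun y hy => ?_) x hx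
  rw [hue (frontier_subset_closure hy), hve (frontier_subset_closure hy)]
  exact hbdry y hy

end Comparison

/-! ### The two signs of `F` -/

theorem le_of_pos_sInf {α : Type*} {f : α → ℝ} {s : Set α} (h : 0 < sInf (f '' s)) :
    ∀ x ∈ s, sInf (f '' s) ≤ f x := by
  intro x hx
  refine csInf_le ?_ (mem_image_of_mem f hx)
  by_contra hb
  -- The default value of `sInf` on a set unbounded below is `0`.
  exact h.ne' (Real.sInf_of_not_bddBelow hb)

theorem mainTheorem11 (n : ℕ) (Ω : Set (EuclideanSpace ℝ (Fin n)))
    (hΩ_open : IsOpen Ω) (hΩ_conn : IsConnected Ω) (hΩ_bdd : Bornology.IsBounded Ω)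
    (u v F : EuclideanSpace ℝ (Fin n) → ℝ)
    (hu : ContinuousOn u (closure Ω)) (hv : ContinuousOn v (closure Ω))
    (hF : ContinuousOn F Ω)
    (hFsign : 0 < sInf (F '' Ω) ∨ sSup (F '' Ω) < 0)
    (hv_super : IsViscositySupersolution Ω F v)
    (hu_sub : IsViscositySubsolution Ω F u)
    (h_bdry : ∀ x ∈ frontier Ω, u x ≤ v x) :
    ∀ x ∈ Ω, u x ≤ v x := by
  rcases hFsign with h | h
  · exact comparison_of_pos_of_continuousOn hΩ_open hΩ_bdd hu hv hF h (le_of_pos_sInf h)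
      hv_super hu_sub h_bdry
  · have hb : BddAbove (F '' Ω) := by
      by_contra hb
      exact h.ne (Real.sSup_of_not_bddAbove hb)
    have key := comparison_of_pos_of_continuousOn hΩ_open hΩ_bdd hv.neg hu.neg hF.neg
      (neg_pos.2 h) (fun x hx => neg_le_neg (le_csSup hb (mem_image_of_mem F hx)))
      hu_sub.neg hv_super.neg (fun x hx => neg_le_neg (h_bdry x hx))
    exact fun x hx => neg_le_neg_iff.1 (key x hx)
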